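/- Let $p$ be a prime, let $r,s$ be positive integers with $s\mid r$, and let $N$ be a positive integer such that $N-1$ divides $p^r-1$. Identify $\mathbb{F}_{p^s}$ with a subfield of $\mathbb{F}_{p^r}$. For $x\in\mathbb{Z}/(N-1)\mathbb{Z}$, the minimal cyclotomic set of $x$ with respect to $p^s$ is $\{p^{si}x \mid i\ge 0\}\subseteq\mathbb{Z}/(N-1)\mathbb{Z}$, and its representative is the least nonnegative integer whose class lies in it; $\mathfrak{I}_a$ denotes the minimal cyclotomic set with representative $a$. Let $a_0=0<a_1<\dots<a_z$ be all the representatives of the minimal cyclotomic sets, and let $a_{N(i)}$ be the representative of the minimal cyclotomic set that contains $N-1-a_i$. Let $0\le t_2<t_1<z$ be indices such that (i) $a_{t_1}<\min\{a_{N(i)}\mid 1\le i\le t_1\}$; (ii) $a_{t_1+1}\le\left\lceil \dfrac{(p^s+1)\,a_{t_2+1}}{p^s}\right\rceil$. For $j=1,2$ put $\Delta_{t_j}=\mathfrak{I}_{a_1}\cup\dots\cup\mathfrak{I}_{a_{t_j}}$ (empty if $t_j=0$), let $E_{\Delta_{t_j}}\subseteq\mathbb{F}_{p^r}^{N-1}$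 be the $\mathbb{F}_{p^r}$-span of the vectors $(P^{e})_{P^{N-1}=1}$ (indexed by the zeros $P$ of $X^{N-1}-1$ in $\mathbb{F}_{p^r}$), where $e$ runs over the integers $0\le e\le N-2$ whose class lies in $\Delta_{t_j}$, and let $E^{\sigma}_{\Delta_{t_j}}=E_{\Delta_{t_j}}\cap\mathbb{F}_{p^s}^{N-1}$ be the subfield-subcode. An $[[n,k,\ge d]]_{q}$ stabilizer code is a common eigenspace $\mathcal{C}\subseteq\mathbb{C}^{q^n}$, of dimension $q^k$, of an abelian subgroup $S$ of the group of errors $\omega^c X(a)Z(b)$ ($\omega=e^{2\pi i/p}$, $0\le c<p$, $a,b\in\mathbb{F}_q^n$, $X(a)|x\rangle=|x+a\rangle$, $Z(b)|x\rangle=\omega^{\mathrm{tr}(b\cdot x)}|x\rangle$), that detects every error of weight less than $d$; here the weight of $\omega^cX(a)Z(b)$ is the number of $i$ with $(a_i,b_i)\ne(0,0)$, and $\mathcal{C}$ detects an error $g$ if $\langle\varphi|g|\psi\rangle=\kappa\langle\varphi|\psi\rangle$ for all $\varphi,\psi\in\mathcal{C}$, with $\kappa$ depending on $g$ only. The labels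 of $S$ are the pairs $(a,b)$ such that $\omega^cX(a)Z(b)\in S$ for some $c$. Then: 1. there is a stabilizer code with parameters $$[[N-1,\;N-1-2\,\mathrm{card}(\Delta_{t_1}),\;\ge a_{t_1+1}]]_{p^s}$$ such that the set of labels of $S$ is $E^{\sigma}_{\Delta_{t_1}}\times E^{\sigma}_{\Delta_{t_1}}$; 2. if $\mathrm{card}(\Delta_{t_1})-\mathrm{card}(\Delta_{t_2})\ge 2$, there is a stabilizer code with parameters $$[[N-1,\;N-1-(\mathrm{card}(\Delta_{t_1})+\mathrm{card}(\Delta_{t_2})),\;\ge a_{t_1+1}]]_{p^s}$$ obtained by Hamada's enlargement from the Euclidean dual codes $C=(E^{\sigma}_{\Delta_{t_1}})^{\perp}$ and $C'=(E^{\sigma}_{\Delta_{t_2}})^{\perp}$; that is, the set of labels of $S$ is the dual, for the symplectic form $((a,b),(u,v))\mapsto b\cdot u-a\cdot v$, of a code of the form $C\times C+\{(u,f(u))\mid u\in M\}$, where $C'=C\oplus M$ and $f\colon M\to M$ is an $\mathbb{F}_{p^s}$-linear map without eigenvalues in $\mathbb{F}_{p^s}$. -/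

import Mathlib

namespace QuantumCodes

open scoped Matrix

noncomputable section

/-! ### Cyclotomic sets modulo `n` with respect to `Q` -/

/-- The minimal cyclotomic set in `ℤ/nℤ` with respect to `Q` that is generated by `x`:
all the elements `Q ^ i * x`, `i ≥ 0`. -/
def cyclotomicSet (n Q : ℕ) (x : ZMod n) : Set (ZMod n) :=
  {y | ∃ i : ℕ, y = (Q : ZMod n) ^ i * x}

/-- The representative of the minimal cyclotomic set of `x`: the least nonnegative integer
whose class lies in that set. -/
def cyclotomicRep (n Q : ℕ) (x : ZMod n) : ℕ :=
  sInf (ZMod.val '' cyclotomicSet n Q x)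

/-- The set of the representatives of all the minimal cyclotomic sets. -/
def cyclotomicReps (n Q : ℕ) : Set ℕ :=
  Set.range (cyclotomicRep n Q)

/-- The union of the minimal cyclotomic sets of `a 1, …, a t` (the one of `a 0` is left out). -/
def cyclotomicUnion (n Q : ℕ) (a : ℕ → ℕ) (t : ℕ) : Set (ZMod n) :=
  ⋃ i ∈ Set.Icc 1 t, cyclotomicSet n Q (a i : ZMod n)

/-! ### Univariate affine variety codes for `J = {1}`, and linear codes -/

/-- The zero set in `F` of `X ^ n - 1`; its elements are the evaluation points. -/
abbrev ZeroSet (F : Type*) [Field F] (n : ℕ) : Type _ := {x : F // x ^ n = 1}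

/-- The `J`-affine variety code of `Δ` for one variable and `J = {1}`: the `F`-span of the
evaluations of the monomials `X ^ e`, `e ∈ Δ`, at the zeros of `X ^ n - 1`. -/
def affineVarietyCode (F : Type*) [Field F] (n : ℕ) (Δ : Set (ZMod n)) :
    Submodule F (ZeroSet F n → F) :=
  Submodule.span F ((fun (e : ZMod n) (x : ZeroSet F n) => (x : F) ^ e.val) '' Δ)

/-- The subfield-subcode `E ∩ K ^ ι` of a code `E` over the extension `F` of `K`. -/
def subfieldSubcode (K : Type*) {F ι : Type*} [Field K] [Field F] [Algebra K F]
    (E : Submodule F (ι → F)) : Submodule K (ι → K) where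
  carrier := {c | (fun i => algebraMap K F (c i)) ∈ E}
  zero_mem' := by
    have h : (fun i : ι => algebraMap K F ((0 : ι → K) i)) = 0 := by ext; simp
    simp only [Set.mem_ofPred_eq]; rw [h]; exact E.zero_mem
  add_mem' := by
    intro c d hc hd
    have h : (fun i : ι => algebraMap K F ((c + d) i)) =
        (fun i => algebraMap K F (c i)) + fun i => algebraMap K F (d i) := by ext; simp
    simp only [Set.mem_ofPred_eq] at *; rw [h]; exact E.add_mem hc hd
  smul_mem' := by
    intro k c hc
    have h : (fun i : ι => algebraMap K F ((k • c) i)) =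
        algebraMap K F k • fun i => algebraMap K F (c i) := by ext; simp
    simp only [Set.mem_ofPred_eq] at *; rw [h]; exact E.smul_mem _ hc

section LinearCodes

variable {K ι : Type*} [Field K] [Fintype ι]

/-- The dual of a linear code for the Euclidean product `x ⬝ᵥ y = ∑ i, x i * y i`. -/
def euclideanDual (E : Submodule K (ι → K)) : Submodule K (ι → K) where
  carrier := {x | ∀ y ∈ E, x ⬝ᵥ y = 0}
  zero_mem' := by intro y _; simp
  add_mem' := by intro x x' hx hx' y hy; rw [add_dotProduct, hx y hy, hx' y hy, add_zero]
  smul_mem' := by intro k x hx y hy; rw [smul_dotProduct, hx y hy, smul_zero]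

/-- The dual of a linear code in `K ^ (2n)` for the symplectic form
`((a, b), (u, v)) ↦ b ⬝ᵥ u - a ⬝ᵥ v`. -/
def symplecticDual (L : Submodule K ((ι → K) × (ι → K))) : Set ((ι → K) × (ι → K)) :=
  {w | ∀ z ∈ L, w.2 ⬝ᵥ z.1 - w.1 ⬝ᵥ z.2 = 0}

/-- `L` is a Steane–Hamada enlargement of `C × C` for linear codes `C ≤ C'`: if `D` generates
`C` and the rows of `G` extend it to a basis of `C'`, then `L` is generated by the rows of
`(D, 0)`, `(0, D)` and `(G, A G)`, where `A` is a matrix without eigenvalues in `K`. Here the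
row space of `G` is `M`, and `A` is a linear map `f : M → M`. -/
def IsHamadaEnlargement (C C' : Submodule K (ι → K))
    (L : Submodule K ((ι → K) × (ι → K))) : Prop :=
  ∃ M : Submodule K (ι → K), Disjoint C M ∧ C ⊔ M = C' ∧
    ∃ f : M →ₗ[K] M, (∀ (κ : K) (u : M), f u = κ • u → u = 0) ∧
      L = C.prod C ⊔ LinearMap.range (M.subtype.prod (M.subtype ∘ₗ f))

end LinearCodes

/-! ### Stabilizer codes over a finite field `K` of characteristic `p` -/

section Stabilizer

/-- The state space `ℂ ^ (q ^ n)`, with basis indexed by `K ^ ι`, `q = |K|`, `n = |ι|`. -/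
abbrev StateSpace (K ι : Type*) : Type _ := (ι → K) → ℂ

variable (p : ℕ) [Fact p.Prime] {K ι : Type*} [Field K] [Algebra (ZMod p) K] [Fintype ι]

/-- The additive character `x ↦ exp (2 π i tr(x) / p)` of `K`, with `tr : K → 𝔽_p` the trace. -/
def traceChar (K : Type*) [Field K] [Algebra (ZMod p) K] : AddChar K ℂ :=
  (ZMod.stdAddChar (N := p)).compAddMonoidHom (Algebra.trace (ZMod p) K).toAddMonoidHom

/-- The error `ω ^ c X(a) Z(b)` where `ω = exp (2 π i / p)`, `X(a) |x⟩ = |x + a⟩` and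
`Z(b) |x⟩ = ω ^ tr(b ⬝ᵥ x) |x⟩`, as an invertible operator on the state space. -/
def errorOp (c : ZMod p) (a b : ι → K) : StateSpace K ι ≃ₗ[ℂ] StateSpace K ι where
  toFun φ x := ZMod.stdAddChar c * traceChar p K (b ⬝ᵥ (x - a)) * φ (x - a)
  map_add' φ ψ := by ext x; simp [mul_add]
  map_smul' k φ := by ext x; simp; ring
  invFun φ x := ZMod.stdAddChar (-c) * traceChar p K (-(b ⬝ᵥ x)) * φ (x + a)
  left_inv φ := by
    ext x
    simp only [add_sub_cancel_right]
    have h1 : (ZMod.stdAddChar (-c) : ℂ) * ZMod.stdAddChar c = 1 := by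
      rw [← AddChar.map_add_eq_mul, neg_add_cancel, AddChar.map_zero_eq_one]
    have h2 : traceChar p K (-(b ⬝ᵥ x)) * traceChar p K (b ⬝ᵥ x) = 1 := by
      rw [← AddChar.map_add_eq_mul, neg_add_cancel, AddChar.map_zero_eq_one]
    linear_combination (φ x) * h1 * traceChar p K (-(b ⬝ᵥ x)) * traceChar p K (b ⬝ᵥ x) +
      φ x * h2
  right_inv φ := by
    ext x
    simp only [sub_add_cancel]
    have h1 : (ZMod.stdAddChar c : ℂ) * ZMod.stdAddChar (-c) = 1 := by
      rw [← AddChar.map_add_eq_mul, add_neg_cancel, AddChar.map_zero_eq_one]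
    have h2 : traceChar p K (b ⬝ᵥ (x - a)) * traceChar p K (-(b ⬝ᵥ (x - a))) = 1 := by
      rw [← AddChar.map_add_eq_mul, add_neg_cancel, AddChar.map_zero_eq_one]
    linear_combination
      (φ x) * h1 * traceChar p K (b ⬝ᵥ (x - a)) * traceChar p K (-(b ⬝ᵥ (x - a))) + φ x * h2

/-- The error group `G_n`: it consists of the errors `ω ^ c X(a) Z(b)`, and it is generated by
the error basis of the operators `X(a) Z(b)`. -/
def errorGroup (K ι : Type*) [Field K] [Algebra (ZMod p) K] [Fintype ι] :
    Subgroup (StateSpace K ι ≃ₗ[ℂ] StateSpace K ι) where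
  carrier := {g | ∃ (c : ZMod p) (a b : ι → K), g = errorOp p c a b}
  one_mem' := by
    refine ⟨0, 0, 0, ?_⟩
    ext φ x
    simp [errorOp]
  mul_mem' := by
    rintro _ _ ⟨c, a, b, rfl⟩ ⟨c', a', b', rfl⟩
    refine ⟨c + c' + Algebra.trace (ZMod p) K (b ⬝ᵥ a'), a + a', b + b', ?_⟩
    refine LinearEquiv.ext fun φ => funext fun x => ?_
    have h : (ZMod.stdAddChar (Algebra.trace (ZMod p) K (b ⬝ᵥ a')) : ℂ) =
      traceChar p K (b ⬝ᵥ a') := rfl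
    have e : b ⬝ᵥ (x - a) = b ⬝ᵥ a' + b ⬝ᵥ (x - (a + a')) := by
      rw [← dotProduct_add]; congr 1; abel
    have e' : x - a - a' = x - (a + a') := by abel
    simp only [LinearEquiv.mul_apply, errorOp, LinearEquiv.coe_mk, LinearMap.coe_mk,
      AddHom.coe_mk, AddChar.map_add_eq_mul, add_dotProduct, h, e, e']
    ring
  inv_mem' := by
    rintro _ ⟨c, a, b, rfl⟩
    refine ⟨-c - Algebra.trace (ZMod p) K (-(b ⬝ᵥ a)), -a, -b, ?_⟩
    refine LinearEquiv.ext fun φ => funext fun x => ?_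
    have h : (ZMod.stdAddChar (Algebra.trace (ZMod p) K (b ⬝ᵥ a)) : ℂ) =
      traceChar p K (b ⬝ᵥ a) := rfl
    have h2 : traceChar p K (b ⬝ᵥ a) * traceChar p K (-(b ⬝ᵥ a)) = 1 := by
      rw [← AddChar.map_add_eq_mul, add_neg_cancel, AddChar.map_zero_eq_one]
    change ZMod.stdAddChar (-c) * traceChar p K (-(b ⬝ᵥ x)) * φ (x + a) =
      ZMod.stdAddChar (-c - Algebra.trace (ZMod p) K (-(b ⬝ᵥ a))) *
        traceChar p K (-b ⬝ᵥ (x - -a)) * φ (x - -a)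
    simp only [map_neg, sub_neg_eq_add, neg_dotProduct, dotProduct_add,
      AddChar.map_add_eq_mul, h]
    linear_combination -(ZMod.stdAddChar (-c) : ℂ) * traceChar p K (-(b ⬝ᵥ x)) * φ (x + a) * h2

/-- The weight of the errors `ω ^ c X(a) Z(b)`: the number of positions on which they act by a
non-scalar operator, that is, in which `(a i, b i) ≠ (0, 0)`. -/
def errorWeight (a b : ι → K) : ℕ := {i : ι | (a i, b i) ≠ (0, 0)}.ncard

/-- `C` is the stabilizer code of `S` for the eigenvalues `χ`: `S` is an abelian subgroup of the
error group and `C ≠ 0` is the common eigenspace of the elements `g` of `S`, with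
eigenvalue `χ g`. -/
structure IsStabilizerCode (S : Subgroup (StateSpace K ι ≃ₗ[ℂ] StateSpace K ι))
    (χ : (StateSpace K ι ≃ₗ[ℂ] StateSpace K ι) → ℂ)
    (C : Submodule ℂ (StateSpace K ι)) : Prop where
  le_errorGroup : S ≤ errorGroup p K ι
  abelian : ∀ g ∈ S, ∀ h ∈ S, g * h = h * g
  mem_iff : ∀ φ, φ ∈ C ↔ ∀ g ∈ S, g φ = χ g • φ
  ne_bot : C ≠ ⊥

/-- The pairs `(a, b)` for which `S` contains some error `ω ^ c X(a) Z(b)`. -/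
def labels (S : Subgroup (StateSpace K ι ≃ₗ[ℂ] StateSpace K ι)) : Set ((ι → K) × (ι → K)) :=
  {w | ∃ c : ZMod p, errorOp p c w.1 w.2 ∈ S}

/-- The quantum code `C` detects the error `g` (or `g` has no effect on it):
`⟨φ | g | ψ⟩ = κ ⟨φ | ψ⟩` for all states `φ`, `ψ` of `C`, with `κ` depending on `g` only;
equivalently `P g P = κ P` for the orthogonal projection `P` onto `C`. -/
def Detects [Fintype K] [DecidableEq ι] (C : Submodule ℂ (StateSpace K ι))
    (g : StateSpace K ι ≃ₗ[ℂ] StateSpace K ι) : Prop :=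
  ∃ κ : ℂ, ∀ φ ∈ C, ∀ ψ ∈ C, star φ ⬝ᵥ g ψ = κ * (star φ ⬝ᵥ ψ)

/-- `C` has parameters `[[n, k, ≥ d]]_q`, `q = |K|`: its length is `n`, its dimension is `q ^ k`,
and it detects all the errors of weight less than `d`, so that its minimum distance is at
least `d`. -/
structure HasParameters [Fintype K] [DecidableEq ι] (C : Submodule ℂ (StateSpace K ι))
    (n k d : ℕ) : Prop where
  length : Fintype.card ι = n
  dimension : Module.finrank ℂ C = Fintype.card K ^ k
  distance : ∀ (c : ZMod p) (a b : ι → K), errorWeight a b < d → Detects C (errorOp p c a b)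

end Stabilizer

end

end QuantumCodes

namespace QuantumCodes

open scoped Matrix

/-! ### Cyclotomic sets -/

section Cyclotomic

variable {n Q : ℕ}

/-! Write `n = N - 1`, `q = p ^ s`, and let `E` be the subfield-subcode of a union `Δ` of nonzero
cyclotomic sets. The theorem rests on three facts about `E`.

Dimension: `Δ` is stable under `q`, so the words `tr(l x ^ e)`, `e ∈ Δ`, lie in `E`. Testing a dual
word against them makes its Fourier transform vanish on `Δ`; two upper bounds that add up to `n`
then force `dim E = card Δ` (`finrank_subfieldSubcode_affineVarietyCode`). Self-orthogonality:
monomial words of exponents `d`, `e` are orthogonal unless `d + e = 0`, and hypothesis (i) says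
exactly that no two elements of `Δ₁` are opposite (`neg_notMem_cyclotomicUnion`). Distance: `Δ`
contains every integer strictly between `0` and the next representative, so the BCH bound applies to
the dual of `E`.

On the quantum side, a space `W` of labels on which `b ⬝ᵥ a'` vanishes gives commuting errors `X(a)
Z(b)` that form a group without any choice of phases. Their common fixed space has dimension `q ^ n
/ card W` by averaging traces, and it detects each error whose label is not symplectically
orthogonal to `W` (`exists_stabilizerCode`). Part 1 takes `W = E₁ × E₁`. Part 2 takes for `W` the
symplectic dual of an enlargement of `C × C`; a word `(a, b)` outside `C × C` yields `q + 1` nonzero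
words `a + κ b`, `b` of `C'`, which improves the distance by the factor `1 + 1 / q` of hypothesis
(ii). -/

theorem self_mem_cyclotomicSet (x : ZMod n) : x ∈ cyclotomicSet n Q x := ⟨0, by simp⟩

theorem mul_mem_cyclotomicSet {x y : ZMod n} (h : y ∈ cyclotomicSet n Q x) :
    (Q : ZMod n) * y ∈ cyclotomicSet n Q x := by
  obtain ⟨i, rfl⟩ := h
  exact ⟨i + 1, by ring⟩

theorem neg_mem_cyclotomicSet {x y : ZMod n} (h : y ∈ cyclotomicSet n Q x) :
    -y ∈ cyclotomicSet n Q (-x) := by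
  obtain ⟨i, rfl⟩ := h
  exact ⟨i, by ring⟩

theorem cyclotomicSet_subset {x y : ZMod n} (h : y ∈ cyclotomicSet n Q x) :
    cyclotomicSet n Q y ⊆ cyclotomicSet n Q x := by
  rintro _ ⟨j, rfl⟩
  obtain ⟨i, rfl⟩ := h
  exact ⟨j + i, by ring⟩

/-- `Q` is a unit modulo `n`, so a suitable nonnegative power of `Q` undoes `Q ^ i`. This makes the
cyclotomic sets a partition. -/
theorem mem_cyclotomicSet_comm (hQ : Q.Coprime n) {x y : ZMod n}
    (h : y ∈ cyclotomicSet n Q x) : x ∈ cyclotomicSet n Q y := by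
  obtain ⟨i, rfl⟩ := h
  have h1 : (Q : ZMod n) ^ n.totient = 1 := by
    have h := congrArg Units.val (ZMod.pow_totient (ZMod.unitOfCoprime Q hQ))
    rwa [Units.val_pow_eq_pow_val, ZMod.coe_unitOfCoprime, Units.val_one] at h
  -- The totient vanishes only for `n = 0`, where coprimality forces `Q = 1`.
  rcases Nat.eq_zero_or_pos n.totient with h0 | hpos
  · rw [Nat.totient_eq_zero] at h0
    subst h0
    have hQ1 : Q = 1 := by simpa using hQ
    subst hQ1
    exact ⟨0, by simp⟩
  · refine ⟨i * (n.totient - 1), ?_⟩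
    rw [← mul_assoc, ← pow_add, ← Nat.mul_succ, Nat.succ_eq_add_one, Nat.sub_add_cancel hpos,
      mul_comm i, pow_mul, h1, one_pow, one_mul]

theorem cyclotomicSet_eq_of_mem (hQ : Q.Coprime n) {x y : ZMod n}
    (h : y ∈ cyclotomicSet n Q x) : cyclotomicSet n Q y = cyclotomicSet n Q x :=
  (cyclotomicSet_subset h).antisymm (cyclotomicSet_subset (mem_cyclotomicSet_comm hQ h))

theorem cyclotomicRep_eq_of_mem (hQ : Q.Coprime n) {x y : ZMod n}
    (h : y ∈ cyclotomicSet n Q x) : cyclotomicRep n Q y = cyclotomicRep n Q x := by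
  rw [cyclotomicRep, cyclotomicRep, cyclotomicSet_eq_of_mem hQ h]

theorem exists_val_eq_cyclotomicRep (x : ZMod n) :
    ∃ y ∈ cyclotomicSet n Q x, y.val = cyclotomicRep n Q x :=
  Nat.sInf_mem (s := ZMod.val '' cyclotomicSet n Q x) ⟨_, x, self_mem_cyclotomicSet x, rfl⟩

theorem cyclotomicRep_le_val (x : ZMod n) : cyclotomicRep n Q x ≤ x.val :=
  Nat.sInf_le ⟨x, self_mem_cyclotomicSet x, rfl⟩

theorem cyclotomicRep_zero : cyclotomicRep n Q 0 = 0 := by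
  have h := cyclotomicRep_le_val (n := n) (Q := Q) 0
  rw [ZMod.val_zero] at h
  exact Nat.le_zero.mp h

theorem cyclotomicRep_eq_zero_iff (hQ : Q.Coprime n) {x : ZMod n} :
    cyclotomicRep n Q x = 0 ↔ x = 0 := by
  refine ⟨fun h => ?_, fun h => by rw [h, cyclotomicRep_zero]⟩
  obtain ⟨y, hy, hv⟩ := exists_val_eq_cyclotomicRep (Q := Q) x
  rw [h, ZMod.val_eq_zero] at hv
  subst hv
  obtain ⟨i, hi⟩ := mem_cyclotomicSet_comm hQ hy
  simpa using hi

variable {z : ℕ} {a : ℕ → ℕ}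

theorem mul_mem_cyclotomicUnion {t : ℕ} {x : ZMod n} (hx : x ∈ cyclotomicUnion n Q a t) :
    (Q : ZMod n) * x ∈ cyclotomicUnion n Q a t := by
  simp only [cyclotomicUnion, Set.mem_iUnion, exists_prop] at hx ⊢
  obtain ⟨i, hi, h⟩ := hx
  exact ⟨i, hi, mul_mem_cyclotomicSet h⟩

theorem cyclotomicUnion_mono {t t' : ℕ} (h : t ≤ t') :
    cyclotomicUnion n Q a t ⊆ cyclotomicUnion n Q a t' :=
  Set.biUnion_subset_biUnion_left (Set.Icc_subset_Icc_right h)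

theorem enum_zero (ha : StrictMonoOn a (Set.Iic z))
    (haA : a '' Set.Iic z = cyclotomicReps n Q) : a 0 = 0 := by
  obtain ⟨j, hj, h0⟩ : 0 ∈ a '' Set.Iic z := haA ▸ ⟨0, cyclotomicRep_zero⟩
  have := ha.monotoneOn (Set.mem_Iic.mpr (Nat.zero_le z)) hj (Nat.zero_le j)
  omega

variable [NeZero n]

theorem cast_cyclotomicRep_mem (x : ZMod n) :
    (cyclotomicRep n Q x : ZMod n) ∈ cyclotomicSet n Q x := by
  obtain ⟨y, hy, hv⟩ := exists_val_eq_cyclotomicRep (Q := Q) x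
  rwa [← hv, ZMod.natCast_zmod_val]

theorem cyclotomicRep_lt (x : ZMod n) : cyclotomicRep n Q x < n :=
  (cyclotomicRep_le_val x).trans_lt (ZMod.val_lt x)

theorem mem_cyclotomicSet_of_cyclotomicRep_eq (hQ : Q.Coprime n) {x y : ZMod n}
    (h : cyclotomicRep n Q x = cyclotomicRep n Q y) : x ∈ cyclotomicSet n Q y := by
  have hx := cast_cyclotomicRep_mem (Q := Q) x
  have hy := cast_cyclotomicRep_mem (Q := Q) y
  rw [← h] at hy
  rw [← cyclotomicSet_eq_of_mem hQ hy]
  exact mem_cyclotomicSet_comm hQ hx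

theorem cyclotomicRep_cast_enum (hQ : Q.Coprime n)
    (haA : a '' Set.Iic z = cyclotomicReps n Q) {i : ℕ} (hi : i ≤ z) :
    cyclotomicRep n Q (a i : ZMod n) = a i := by
  obtain ⟨x, hx⟩ : a i ∈ cyclotomicReps n Q := haA ▸ ⟨i, hi, rfl⟩
  rw [← hx, cyclotomicRep_eq_of_mem hQ (cast_cyclotomicRep_mem x)]

/-- The enumeration is increasing and exhausts the representatives, so an index range becomes a
range of representatives. -/
theorem mem_cyclotomicUnion_iff (hQ : Q.Coprime n) (ha : StrictMonoOn a (Set.Iic z))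
    (haA : a '' Set.Iic z = cyclotomicReps n Q) {t : ℕ} (ht : t + 1 ≤ z) {x : ZMod n} :
    x ∈ cyclotomicUnion n Q a t ↔
      0 < cyclotomicRep n Q x ∧ cyclotomicRep n Q x < a (t + 1) := by
  simp only [cyclotomicUnion, Set.mem_iUnion, exists_prop]
  constructor
  · rintro ⟨i, ⟨h1, h2⟩, hx⟩
    have hiz : i ≤ z := by omega
    rw [cyclotomicRep_eq_of_mem hQ hx, cyclotomicRep_cast_enum hQ haA hiz]
    have h0 : a 0 < a i :=
      ha (Set.mem_Iic.mpr (Nat.zero_le z)) (Set.mem_Iic.mpr hiz) (by omega)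
    exact ⟨by omega, ha (Set.mem_Iic.mpr hiz) (Set.mem_Iic.mpr ht) (by omega)⟩
  · rintro ⟨h1, h2⟩
    obtain ⟨j, hj, hjx⟩ : cyclotomicRep n Q x ∈ a '' Set.Iic z := haA ▸ ⟨x, rfl⟩
    rw [← hjx] at h1 h2
    have hjt : j < t + 1 := (ha.lt_iff_lt hj (Set.mem_Iic.mpr ht)).mp h2
    have hj0 : j ≠ 0 := by
      rintro rfl
      rw [enum_zero ha haA] at h1
      exact h1.false
    refine ⟨j, ⟨by omega, by omega⟩, mem_cyclotomicSet_of_cyclotomicRep_eq hQ ?_⟩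
    rw [cyclotomicRep_cast_enum hQ haA hj, hjx]

/-- A representative never exceeds an element of its class. This supplies the run of consecutive
exponents for the BCH bound. -/
theorem cast_mem_cyclotomicUnion (hQ : Q.Coprime n) (ha : StrictMonoOn a (Set.Iic z))
    (haA : a '' Set.Iic z = cyclotomicReps n Q) {t : ℕ} (ht : t + 1 ≤ z) {e : ℕ} (h0 : 0 < e)
    (he : e < a (t + 1)) : e < n ∧ (e : ZMod n) ∈ cyclotomicUnion n Q a t := by
  have hen : e < n := he.trans (cyclotomicRep_cast_enum hQ haA ht ▸ cyclotomicRep_lt _)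
  have hval : (e : ZMod n).val = e := ZMod.val_cast_of_lt hen
  refine ⟨hen, (mem_cyclotomicUnion_iff hQ ha haA ht).mpr ⟨Nat.pos_of_ne_zero fun h => ?_, ?_⟩⟩
  · rw [cyclotomicRep_eq_zero_iff hQ, ← ZMod.val_eq_zero, hval] at h
    omega
  · exact ((cyclotomicRep_le_val _).trans_eq hval).trans_lt he

/-- If `x` is in the class of `a i` and `-x` in that of `a j`, then the representative of `-a i` is
`a j ≤ a t`, against hypothesis (i). -/
theorem neg_notMem_cyclotomicUnion (hQ : Q.Coprime n) (ha : StrictMonoOn a (Set.Iic z))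
    (haA : a '' Set.Iic z = cyclotomicReps n Q) {t : ℕ} (ht : t + 1 ≤ z)
    (hi : ∀ i ∈ Set.Icc 1 t, a t < cyclotomicRep n Q ((n - a i : ℕ) : ZMod n)) {x : ZMod n}
    (hx : x ∈ cyclotomicUnion n Q a t) : -x ∉ cyclotomicUnion n Q a t := by
  simp only [cyclotomicUnion, Set.mem_iUnion, exists_prop] at hx ⊢
  rintro ⟨j, ⟨hj1, hjt⟩, hj⟩
  obtain ⟨i, hit, h⟩ := hx
  have hiz : i ≤ z := by have := hit.2; omega
  have han : a i ≤ n := (cyclotomicRep_cast_enum hQ haA hiz ▸ cyclotomicRep_lt (n := n) _).le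
  have h1 := hi i hit
  rw [Nat.cast_sub han, ZMod.natCast_self, zero_sub,
    ← cyclotomicRep_eq_of_mem hQ (neg_mem_cyclotomicSet h), cyclotomicRep_eq_of_mem hQ hj,
    cyclotomicRep_cast_enum hQ haA (by omega)] at h1
  have := ha.monotoneOn (Set.mem_Iic.mpr (by omega : j ≤ z)) (Set.mem_Iic.mpr (by omega : t ≤ z))
    hjt
  omega

end Cyclotomic

/-! ### Duality of linear codes -/

section Duality

variable {K ι : Type*} [Field K] [Fintype ι]

/-- The Euclidean product as a bilinear form. -/
def euclideanForm (K ι : Type*) [Field K] [Fintype ι] : LinearMap.BilinForm K (ι → K) :=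
  LinearMap.mk₂ K (fun y x => x ⬝ᵥ y) (fun _ _ _ => dotProduct_add _ _ _)
    (fun _ _ _ => dotProduct_smul _ _ _) (fun _ _ _ => add_dotProduct _ _ _)
    (fun _ _ _ => smul_dotProduct _ _ _)

theorem euclideanForm_isRefl : (euclideanForm K ι).IsRefl := fun x y h => by
  rw [← h]
  exact dotProduct_comm _ _

theorem euclideanForm_nondegenerate : (euclideanForm K ι).Nondegenerate := by
  classical
  refine (LinearMap.IsRefl.nondegenerate_iff_separatingLeft
    (fun x y h => euclideanForm_isRefl x y h)).mpr fun x hx => ?_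
  ext i
  simpa [euclideanForm] using hx (Pi.single i 1)

theorem euclideanDual_eq_orthogonal (E : Submodule K (ι → K)) :
    euclideanDual E = (euclideanForm K ι).orthogonal E := rfl

theorem finrank_euclideanDual_add (E : Submodule K (ι → K)) :
    Module.finrank K (euclideanDual E) + Module.finrank K E = Fintype.card ι := by
  have h := LinearMap.BilinForm.finrank_orthogonal (euclideanForm_nondegenerate (K := K) (ι := ι)) E
  have h' := E.finrank_le
  rw [Module.finrank_fintype_fun_eq_card] at h h'
  rw [euclideanDual_eq_orthogonal, h]
  omega

theorem euclideanDual_euclideanDual (E : Submodule K (ι → K)) :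
    euclideanDual (euclideanDual E) = E :=
  (euclideanForm K ι).orthogonal_orthogonal euclideanForm_nondegenerate euclideanForm_isRefl E

theorem euclideanDual_anti {E E' : Submodule K (ι → K)} (h : E ≤ E') :
    euclideanDual E' ≤ euclideanDual E := fun _ hx y hy => hx y (h hy)

/-- The symplectic form `((a, b), (u, v)) ↦ b ⬝ᵥ u - a ⬝ᵥ v`, with the arguments swapped. -/
def symplecticForm (K ι : Type*) [Field K] [Fintype ι] :
    LinearMap.BilinForm K ((ι → K) × (ι → K)) :=
  LinearMap.mk₂ K (fun z w => w.2 ⬝ᵥ z.1 - w.1 ⬝ᵥ z.2)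
    (fun _ _ _ => by simp only [Prod.fst_add, Prod.snd_add, dotProduct_add]; ring)
    (fun _ _ _ => by simp only [Prod.smul_fst, Prod.smul_snd, dotProduct_smul, smul_sub])
    (fun _ _ _ => by simp only [Prod.fst_add, Prod.snd_add, add_dotProduct]; ring)
    (fun _ _ _ => by simp only [Prod.smul_fst, Prod.smul_snd, smul_dotProduct, smul_sub])

theorem symplecticForm_apply (z w : (ι → K) × (ι → K)) :
    symplecticForm K ι z w = w.2 ⬝ᵥ z.1 - w.1 ⬝ᵥ z.2 := rfl

theorem symplecticForm_isRefl : (symplecticForm K ι).IsRefl := fun x y h => by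
  rw [symplecticForm_apply] at h ⊢
  rw [dotProduct_comm x.2, dotProduct_comm x.1, ← neg_sub, h, neg_zero]

theorem symplecticForm_nondegenerate : (symplecticForm K ι).Nondegenerate := by
  classical
  refine (LinearMap.IsRefl.nondegenerate_iff_separatingLeft
    (fun x y h => symplecticForm_isRefl x y h)).mpr fun x hx => ?_
  ext i
  · simpa [symplecticForm_apply] using hx (0, Pi.single i 1)
  · simpa [symplecticForm_apply] using hx (Pi.single i 1, 0)

theorem symplecticDual_eq_orthogonal (L : Submodule K ((ι → K) × (ι → K))) :
    symplecticDual L = (symplecticForm K ι).orthogonal L := rfl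

theorem finrank_symplecticForm_orthogonal_add (L : Submodule K ((ι → K) × (ι → K))) :
    Module.finrank K ((symplecticForm K ι).orthogonal L) + Module.finrank K L =
      2 * Fintype.card ι := by
  have h := LinearMap.BilinForm.finrank_orthogonal
    (symplecticForm_nondegenerate (K := K) (ι := ι)) L
  have h' := L.finrank_le
  rw [Module.finrank_prod, Module.finrank_fintype_fun_eq_card] at h h'
  omega

theorem symplecticForm_orthogonal_orthogonal (L : Submodule K ((ι → K) × (ι → K))) :
    (symplecticForm K ι).orthogonal ((symplecticForm K ι).orthogonal L) = L :=
  LinearMap.BilinForm.orthogonal_orthogonal symplecticForm_nondegenerate symplecticForm_isRefl L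

/-- Pairing with `(0, y)` and `(y, 0)` separates the coordinates; what remains is the Euclidean
double dual. -/
theorem symplecticForm_orthogonal_prod_euclideanDual (E : Submodule K (ι → K)) :
    (symplecticForm K ι).orthogonal ((euclideanDual E).prod (euclideanDual E)) = E.prod E := by
  ext ⟨u, v⟩
  rw [LinearMap.BilinForm.mem_orthogonal_iff, Submodule.mem_prod]
  constructor
  · intro h
    rw [← euclideanDual_euclideanDual E]
    constructor
    · intro y hy
      have := h (0, y) ⟨zero_mem _, hy⟩
      simpa [symplecticForm_apply] using this
    · intro y hy
      have := h (y, 0) ⟨hy, zero_mem _⟩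
      simpa [symplecticForm_apply] using this
  · rintro ⟨hu, hv⟩ ⟨y, w⟩ ⟨hy, hw⟩
    rw [symplecticForm_apply, dotProduct_comm, hy v hv,
      dotProduct_comm, hw u hu, sub_zero]

end Duality

/-! ### Subfield-subcodes of affine variety codes in one variable -/

/-! ### Subfield-subcodes of affine variety codes in one variable -/

section ZeroSet

variable {F : Type*} [Field F] {n : ℕ}

theorem ZeroSet.ne_zero [NeZero n] (x : ZeroSet F n) : (x : F) ≠ 0 := fun h => by
  have := x.2
  rw [h, zero_pow (NeZero.ne n)] at this
  exact zero_ne_one this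

theorem ZeroSet.pow_val_natCast (x : ZeroSet F n) (e : ℕ) :
    (x : F) ^ (e : ZMod n).val = (x : F) ^ e := by
  rw [ZMod.val_natCast, ← pow_eq_pow_mod e x.2]

theorem ZeroSet.pow_val_add [NeZero n] (x : ZeroSet F n) (d e : ZMod n) :
    (x : F) ^ (d + e).val = (x : F) ^ d.val * (x : F) ^ e.val := by
  rw [ZMod.val_add, ← pow_eq_pow_mod _ x.2, pow_add]

theorem ZeroSet.pow_val_natCast_mul [NeZero n] (x : ZeroSet F n) (m : ℕ) (e : ZMod n) :
    (x : F) ^ ((m : ZMod n) * e).val = ((x : F) ^ e.val) ^ m := by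
  conv_lhs => rw [← ZMod.natCast_zmod_val e, ← Nat.cast_mul, x.pow_val_natCast, mul_comm, pow_mul]

variable [Fintype (ZeroSet F n)] [NeZero n]

theorem card_zeroSet {ζ : F} (hζ : IsPrimitiveRoot ζ n) : Fintype.card (ZeroSet F n) = n := by
  rw [Fintype.card_of_subtype (Polynomial.nthRootsFinset n (1 : F)), hζ.card_nthRootsFinset]
  intro x
  rw [Polynomial.mem_nthRootsFinset (NeZero.pos n)]

/-- Multiplication by `ζ` permutes the zeros and scales the sum by `ζ ^ e ≠ 1`. -/
theorem sum_zeroSet_pow_eq_zero {ζ : F} (hζ : IsPrimitiveRoot ζ n) {e : ZMod n} (he : e ≠ 0) :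
    ∑ x : ZeroSet F n, (x : F) ^ e.val = 0 := by
  have hζ0 : ζ ≠ 0 := hζ.ne_zero (NeZero.ne n)
  let σ : ZeroSet F n ≃ ZeroSet F n :=
    { toFun x := ⟨ζ * x, by rw [mul_pow, hζ.pow_eq_one, x.2, one_mul]⟩
      invFun x := ⟨ζ⁻¹ * x, by rw [mul_pow, inv_pow, hζ.pow_eq_one, x.2, inv_one, one_mul]⟩
      left_inv x := Subtype.ext (inv_mul_cancel_left₀ hζ0 _)
      right_inv x := Subtype.ext (mul_inv_cancel_left₀ hζ0 _) }
  have h : ζ ^ e.val * ∑ x : ZeroSet F n, (x : F) ^ e.val = ∑ x : ZeroSet F n, (x : F) ^ e.val := by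
    rw [Finset.mul_sum]
    refine Eq.trans ?_ (Equiv.sum_comp σ fun x => (x : F) ^ e.val)
    exact Finset.sum_congr rfl fun x _ => (mul_pow ζ (x : F) e.val).symm
  by_contra hne
  have h1 : ζ ^ e.val = 1 := mul_right_cancel₀ hne (by rw [h, one_mul])
  refine hζ.pow_ne_one_of_pos_of_lt ?_ (ZMod.val_lt e) h1
  rwa [Ne, ZMod.val_eq_zero]

omit [Fintype (ZeroSet F n)] in
-- The summand is the additive character `e ↦ (x / y) ^ e` of `ℤ/nℤ`, nontrivial at `1`.
theorem sum_exponents_pow_eq_zero {x y : ZeroSet F n} (hxy : x ≠ y) :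
    ∑ e : ZMod n, (x : F) ^ e.val * (y : F) ^ (-e).val = 0 := by
  have hy := y.ne_zero
  have hw : ((x : F) / y) ^ n = 1 := by rw [div_pow, x.2, y.2, div_one]
  have hy' (e : ZMod n) : (y : F) ^ (-e).val = ((y : F) ^ e.val)⁻¹ := by
    refine eq_inv_of_mul_eq_one_left ?_
    rw [← ZeroSet.pow_val_add, neg_add_cancel, ZMod.val_zero, pow_zero]
  calc ∑ e : ZMod n, (x : F) ^ e.val * (y : F) ^ (-e).val
      = ∑ e : ZMod n, AddChar.zmodChar n hw e :=
        Finset.sum_congr rfl fun e _ => by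
          rw [AddChar.zmodChar_apply, hy', div_pow, div_eq_mul_inv]
    _ = 0 := by
      refine AddChar.sum_eq_zero_of_ne_one fun h => hxy ?_
      have h1 := DFunLike.congr_fun h ((1 : ℕ) : ZMod n)
      rw [AddChar.zmodChar_apply, AddChar.one_apply,
        ZeroSet.pow_val_natCast ⟨(x : F) / y, hw⟩ 1, pow_one, div_eq_one_iff_eq hy] at h1
      exact Subtype.ext h1

/-- A word whose Fourier transform vanishes on `Δ` is a combination of the evaluations of the
monomials whose exponents are not in `-Δ`. -/
theorem mem_affineVarietyCode_of_sum_eq_zero (hn : (n : F) ≠ 0) {Δ : Set (ZMod n)}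
    {c : ZeroSet F n → F} (hc : ∀ e ∈ Δ, ∑ x, c x * (x : F) ^ e.val = 0) :
    c ∈ affineVarietyCode F n {e | -e ∉ Δ} := by
  -- Fourier inversion on the group of zeros; dividing by `n` is allowed because `n ≠ 0` in `F`.
  have key : (n : F) • c = ∑ e : ZMod n, (∑ x, c x * (x : F) ^ (-e).val) •
      fun y : ZeroSet F n => (y : F) ^ e.val := by
    ext y
    simp only [Pi.smul_apply, smul_eq_mul, Finset.sum_apply, Finset.sum_mul]
    rw [Finset.sum_comm, Finset.sum_eq_single y]
    · have (e : ZMod n) : c y * (y : F) ^ (-e).val * (y : F) ^ e.val = c y := by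
        rw [mul_assoc, ← ZeroSet.pow_val_add, neg_add_cancel, ZMod.val_zero, pow_zero, mul_one]
      simp_rw [this]
      rw [Finset.sum_const, Finset.card_univ, ZMod.card, nsmul_eq_mul]
    · intro x _ hx
      rw [← mul_zero (c x), ← sum_exponents_pow_eq_zero hx.symm, Finset.mul_sum]
      exact Finset.sum_congr rfl fun e _ => by ring
    · intro h
      exact absurd (Finset.mem_univ y) h
  rw [← inv_smul_smul₀ hn c, key]
  refine Submodule.smul_mem _ _ (Submodule.sum_mem _ fun e _ => ?_)
  by_cases he : -e ∈ Δ
  · rw [hc _ he, zero_smul]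
    exact zero_mem _
  · exact Submodule.smul_mem _ _ (Submodule.subset_span ⟨e, he, rfl⟩)

omit [Fintype (ZeroSet F n)] in
theorem finrank_affineVarietyCode_le (Δ : Set (ZMod n)) :
    Module.finrank F (affineVarietyCode F n Δ) ≤ Δ.ncard := by
  classical
  have := Fintype.ofFinite Δ
  refine (finrank_span_le_card _).trans ?_
  rw [← Set.ncard_eq_toFinset_card']
  exact Set.ncard_image_le

theorem sum_mul_eq_zero_of_mem_affineVarietyCode {ζ : F} (hζ : IsPrimitiveRoot ζ n)
    {Δ Δ' : Set (ZMod n)} (h : ∀ e ∈ Δ, -e ∉ Δ') {c c' : ZeroSet F n → F}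
    (hc : c ∈ affineVarietyCode F n Δ) (hc' : c' ∈ affineVarietyCode F n Δ') :
    c ⬝ᵥ c' = 0 := by
  induction hc using Submodule.span_induction with
  | mem _ hx =>
    obtain ⟨d, hd, rfl⟩ := hx
    induction hc' using Submodule.span_induction with
    | mem _ hx =>
      obtain ⟨e, he, rfl⟩ := hx
      have hde : d + e ≠ 0 := fun h0 => h d hd ((neg_eq_of_add_eq_zero_right h0).symm ▸ he)
      rw [← sum_zeroSet_pow_eq_zero hζ hde]
      exact Finset.sum_congr rfl fun x _ => (x.pow_val_add d e).symm
    | zero => exact dotProduct_zero _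
    | add _ _ _ _ h1 h2 => rw [dotProduct_add, h1, h2, add_zero]
    | smul k _ _ h1 => rw [dotProduct_smul, h1, smul_zero]
  | zero => exact zero_dotProduct _
  | add _ _ _ _ h1 h2 => rw [add_dotProduct, h1, h2, add_zero]
  | smul k _ _ h1 => rw [smul_dotProduct, h1, smul_zero]

/-- The BCH bound. -/
theorem le_ncard_support_of_sum_eq_zero {δ : ℕ} {c : ZeroSet F n → F} (hc0 : c ≠ 0)
    (hc : ∀ e : ℕ, 0 < e → e < δ → ∑ x, c x * (x : F) ^ e = 0) : δ ≤ {x | c x ≠ 0}.ncard := by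
  classical
  rw [Set.ncard_eq_toFinset_card']
  by_contra! hlt
  set s := {x | c x ≠ 0}.toFinset with hs
  have hmem (x) : x ∈ s ↔ c x ≠ 0 := by simp [hs]
  let ψ := s.equivFin
  -- A Vandermonde system on the support. The extra factor `x` shifts the exponents `1, …, card s`
  -- down to `0, …, card s - 1`; they are available since `card s < δ`.
  have hv : (fun j : Fin s.card => c (ψ.symm j) * ((ψ.symm j : ZeroSet F n) : F)) = 0 := by
    refine Matrix.eq_zero_of_forall_pow_sum_mul_pow_eq_zero
      (f := fun j => ((ψ.symm j : ZeroSet F n) : F)) ?_ fun i => ?_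
    · exact (Subtype.val_injective.comp Subtype.val_injective).comp ψ.symm.injective
    · rw [Equiv.sum_comp ψ.symm (fun x : s => c x * ((x : ZeroSet F n) : F) *
        ((x : ZeroSet F n) : F) ^ (i : ℕ)),
        Finset.sum_coe_sort s fun x => c x * (x : F) * (x : F) ^ (i : ℕ),
        ← hc (i + 1) (Nat.succ_pos _) (by have := i.2; omega)]
      rw [Finset.sum_subset (Finset.subset_univ s)]
      · exact Finset.sum_congr rfl fun x _ => by ring
      · intro x _ hx
        rw [hmem, not_not] at hx
        rw [hx, zero_mul, zero_mul]
  refine hc0 (funext fun x => ?_)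
  by_contra hx
  have h := congrFun hv (ψ ⟨x, (hmem x).mpr hx⟩)
  simp only [Equiv.symm_apply_apply, Pi.zero_apply, mul_eq_zero] at h
  exact h.elim hx x.ne_zero

end ZeroSet

/-! ### Descent to the subfield by the trace -/

section SubfieldSubcode

variable {K F : Type*} [Field K] [Field F] [Finite F] [Algebra K F]

theorem eq_zero_of_forall_trace_mul_eq_zero {x : F}
    (h : ∀ l : F, Algebra.trace K F (l * x) = 0) : x = 0 := by
  have := Module.Finite.of_finite (R := K) (M := F)
  have := Finite.of_injective _ (FaithfulSMul.algebraMap_injective K F)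
  exact (traceForm_nondegenerate K F).2 x h

/-- A `K`-basis stays independent over `F`: applying `tr(l ·)` to a relation with coefficients `g j`
gives a `K`-relation with coefficients `tr(l g j)`, which vanish for all `l`. -/
theorem finrank_subfieldSubcode_le {ι : Type*} [Finite ι] (E : Submodule F (ι → F)) :
    Module.finrank K (subfieldSubcode K E) ≤ Module.finrank F E := by
  let b := Module.finBasis K (subfieldSubcode K E)
  have hli : LinearIndependent F fun j =>
      (⟨fun i => algebraMap K F ((b j : ι → K) i), (b j).2⟩ : E) := by
    rw [Fintype.linearIndependent_iff]
    intro g hg j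
    refine eq_zero_of_forall_trace_mul_eq_zero (K := K) fun l => ?_
    refine Fintype.linearIndependent_iff.mp b.linearIndependent
      (fun j => Algebra.trace K F (l * g j)) (Subtype.ext (funext fun i => ?_)) j
    have h := congrArg (fun c : E => Algebra.trace K F (l * (c : ι → F) i)) hg
    simp only [AddSubmonoidClass.coe_finsetSum, SetLike.val_smul, Finset.sum_apply, Pi.smul_apply,
      smul_eq_mul, ZeroMemClass.coe_zero, Pi.zero_apply, mul_zero, map_zero, Finset.mul_sum,
      map_sum] at h ⊢
    rw [← h]
    refine Finset.sum_congr rfl fun k _ => ?_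
    rw [← mul_assoc, mul_comm _ (algebraMap K F _), ← Algebra.smul_def, map_smul, smul_eq_mul,
      mul_comm]
  simpa using hli.fintype_card_le_finrank

variable {n : ℕ} [NeZero n] {Δ : Set (ZMod n)}

/-- The trace is the sum of the Frobenius conjugates, which multiply the exponent by powers of `card
K` and so keep it in `Δ`. -/
theorem trace_monomial_mem (hΔ : ∀ e ∈ Δ, (Nat.card K : ZMod n) * e ∈ Δ) {e : ZMod n} (he : e ∈ Δ)
    (l : F) : (fun x : ZeroSet F n => Algebra.trace K F (l * (x : F) ^ e.val)) ∈
      subfieldSubcode K (affineVarietyCode F n Δ) := by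
  change (fun x : ZeroSet F n => algebraMap K F (Algebra.trace K F (l * (x : F) ^ e.val))) ∈
    affineVarietyCode F n Δ
  have hpow (i : ℕ) : (Nat.card K : ZMod n) ^ i * e ∈ Δ := by
    induction i with
    | zero => simpa using he
    | succ i ih => rw [pow_succ', mul_assoc]; exact hΔ _ ih
  have h : (fun x : ZeroSet F n => algebraMap K F (Algebra.trace K F (l * (x : F) ^ e.val))) =
      ∑ i ∈ Finset.range (Module.finrank K F), l ^ Nat.card K ^ i •
        fun x : ZeroSet F n => (x : F) ^ ((Nat.card K : ZMod n) ^ i * e).val := by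
    ext x
    rw [FiniteField.algebraMap_trace_eq_sum_pow, Finset.sum_apply]
    refine Finset.sum_congr rfl fun i _ => ?_
    rw [Pi.smul_apply, smul_eq_mul, mul_pow, ← Nat.cast_pow, ZeroSet.pow_val_natCast_mul]
  rw [h]
  exact Submodule.sum_mem _ fun i _ =>
    Submodule.smul_mem _ _ (Submodule.subset_span ⟨_, hpow i, rfl⟩)

variable [Fintype (ZeroSet F n)]

/-- Orthogonality to the trace words kills `tr(l S)` for every `l`, where `S` is the Fourier sum;
the trace form is nondegenerate. -/
theorem sum_eq_zero_of_mem_euclideanDual (hΔ : ∀ e ∈ Δ, (Nat.card K : ZMod n) * e ∈ Δ)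
    {c : ZeroSet F n → K}
    (hc : c ∈ euclideanDual (subfieldSubcode K (affineVarietyCode F n Δ))) :
    ∀ e ∈ Δ, ∑ x, algebraMap K F (c x) * (x : F) ^ e.val = 0 := by
  intro e he
  refine eq_zero_of_forall_trace_mul_eq_zero (K := K) fun l => ?_
  rw [← hc _ (trace_monomial_mem hΔ he l), Finset.mul_sum, map_sum]
  refine Finset.sum_congr rfl fun x _ => ?_
  rw [mul_left_comm, ← Algebra.smul_def, map_smul, smul_eq_mul]

/-- A squeeze: the code has dimension at most `card Δ`, its dual at most `n - card Δ`, and the two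
dimensions add up to `n`. -/
theorem finrank_subfieldSubcode_affineVarietyCode {ζ : F} (hζ : IsPrimitiveRoot ζ n)
    (hΔ : ∀ e ∈ Δ, (Nat.card K : ZMod n) * e ∈ Δ) :
    Module.finrank K (subfieldSubcode K (affineVarietyCode F n Δ)) = Δ.ncard := by
  have hn : (n : F) ≠ 0 := hζ.neZero'.ne
  have hle : euclideanDual (subfieldSubcode K (affineVarietyCode F n Δ)) ≤
      subfieldSubcode K (affineVarietyCode F n {e | -e ∉ Δ}) := fun c hc =>
    mem_affineVarietyCode_of_sum_eq_zero hn (sum_eq_zero_of_mem_euclideanDual hΔ hc)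
  have h1 := finrank_euclideanDual_add (subfieldSubcode K (affineVarietyCode F n Δ))
  have h2 := Submodule.finrank_mono hle
  have h3 := (finrank_subfieldSubcode_le (K := K) (affineVarietyCode F n Δ)).trans
    (finrank_affineVarietyCode_le Δ)
  have h4 := (finrank_subfieldSubcode_le (K := K) (affineVarietyCode F n {e | -e ∉ Δ})).trans
    (finrank_affineVarietyCode_le _)
  have h5 : ({e | -e ∉ Δ} : Set (ZMod n)).ncard + Δ.ncard = n := by
    have : ({e | -e ∉ Δ} : Set (ZMod n)) = (fun e => -e) '' Δᶜ := by
      ext e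
      simp
    rw [this, Set.ncard_image_of_injective _ neg_injective, add_comm, Set.ncard_add_ncard_compl,
      Nat.card_zmod]
  rw [card_zeroSet hζ] at h1
  omega

theorem subfieldSubcode_le_euclideanDual {ζ : F} (hζ : IsPrimitiveRoot ζ n)
    (h : ∀ e ∈ Δ, -e ∉ Δ) :
    subfieldSubcode K (affineVarietyCode F n Δ) ≤
      euclideanDual (subfieldSubcode K (affineVarietyCode F n Δ)) := by
  intro c hc c' hc'
  refine FaithfulSMul.algebraMap_injective K F ?_
  rw [map_zero, ← sum_mul_eq_zero_of_mem_affineVarietyCode hζ h hc hc']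
  simp [dotProduct]

omit [Finite F] [NeZero n] [Fintype (ZeroSet F n)] in
theorem subfieldSubcode_affineVarietyCode_mono {Δ' : Set (ZMod n)} (h : Δ' ⊆ Δ) :
    subfieldSubcode K (affineVarietyCode F n Δ') ≤ subfieldSubcode K (affineVarietyCode F n Δ) :=
  fun _ hc => Submodule.span_mono (Set.image_mono h) hc

theorem le_ncard_support_of_mem_euclideanDual (hΔ : ∀ e ∈ Δ, (Nat.card K : ZMod n) * e ∈ Δ)
    {δ : ℕ} (hδ : ∀ e : ℕ, 0 < e → e < δ → (e : ZMod n) ∈ Δ) {c : ZeroSet F n → K} (hc0 : c ≠ 0)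
    (hc : c ∈ euclideanDual (subfieldSubcode K (affineVarietyCode F n Δ))) :
    δ ≤ {x | c x ≠ 0}.ncard := by
  have h := le_ncard_support_of_sum_eq_zero (δ := δ) (c := fun x => algebraMap K F (c x)) ?_ ?_
  · simpa using h
  · intro h
    exact hc0 (funext fun x => by simpa using congrFun h x)
  · intro e h0 he
    rw [← sum_eq_zero_of_mem_euclideanDual hΔ hc _ (hδ e h0 he)]
    exact Finset.sum_congr rfl fun x _ => by rw [x.pow_val_natCast]

end SubfieldSubcode

/-! ### Stabilizer codes of isotropic spaces -/

section ErrorOperators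

variable {p : ℕ} [Fact p.Prime] {K ι : Type*} [Field K] [Algebra (ZMod p) K] [Fintype ι]

theorem errorOp_apply (c : ZMod p) (a b : ι → K) (φ : StateSpace K ι) (x : ι → K) :
    errorOp p c a b φ x =
      ZMod.stdAddChar c * traceChar p K (b ⬝ᵥ (x - a)) * φ (x - a) := rfl

theorem stdAddChar_trace (x : K) :
    (ZMod.stdAddChar (Algebra.trace (ZMod p) K x) : ℂ) = traceChar p K x := rfl

theorem errorOp_zero : errorOp p 0 (0 : ι → K) 0 = 1 := by
  ext φ x
  simp [errorOp_apply]

theorem errorOp_mul (c c' : ZMod p) (a b a' b' : ι → K) :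
    errorOp p c a b * errorOp p c' a' b' =
      errorOp p (c + c' + Algebra.trace (ZMod p) K (b ⬝ᵥ a')) (a + a') (b + b') := by
  refine LinearEquiv.ext fun φ => funext fun x => ?_
  have e : b ⬝ᵥ (x - a) = b ⬝ᵥ a' + b ⬝ᵥ (x - (a + a')) := by
    rw [← dotProduct_add]; congr 1; abel
  have e' : x - a - a' = x - (a + a') := by abel
  simp only [LinearEquiv.mul_apply, errorOp_apply, AddChar.map_add_eq_mul, add_dotProduct,
    stdAddChar_trace, e, e']
  ring

theorem errorOp_add_phase (c t : ZMod p) (a b : ι → K) (φ : StateSpace K ι) :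
    errorOp p (c + t) a b φ = (ZMod.stdAddChar t : ℂ) • errorOp p c a b φ := by
  ext x
  simp only [errorOp_apply, Pi.smul_apply, smul_eq_mul, AddChar.map_add_eq_mul]
  ring

theorem errorOp_zero_zero_apply (c : ZMod p) (φ : StateSpace K ι) :
    errorOp p c 0 0 φ = (ZMod.stdAddChar c : ℂ) • φ := by
  rw [← zero_add c, errorOp_add_phase, errorOp_zero, zero_add]
  rfl

theorem star_addChar_mul_self [Finite K] (x : K) :
    star (traceChar p K x) * traceChar p K x = 1 := by
  rw [← stdAddChar_trace, Complex.star_def, ← AddChar.map_neg_eq_conj, ← AddChar.map_add_eq_mul,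
    neg_add_cancel, AddChar.map_zero_eq_one]

variable [Fintype K]

theorem eq_zero_of_forall_traceChar_mul_eq_one {x : K}
    (h : ∀ l : K, traceChar p K (l * x) = 1) : x = 0 := by
  refine eq_zero_of_forall_trace_mul_eq_zero (K := ZMod p) fun l => ?_
  refine ZMod.injective_stdAddChar ?_
  rw [stdAddChar_trace, h, AddChar.map_zero_eq_one]

variable [DecidableEq ι]

theorem errorOp_unitary (a b : ι → K) (φ ψ : StateSpace K ι) :
    star (errorOp p 0 a b φ) ⬝ᵥ errorOp p 0 a b ψ = star φ ⬝ᵥ ψ := by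
  refine Eq.trans ?_ (Equiv.sum_comp (Equiv.subRight a) fun x => star (φ x) * ψ x)
  refine Finset.sum_congr rfl fun x _ => ?_
  simp only [Pi.star_apply, errorOp_apply, AddChar.map_zero_eq_one, one_mul, star_mul',
    Equiv.subRight_apply]
  linear_combination star (φ (x - a)) * ψ (x - a) * star_addChar_mul_self (p := p) (b ⬝ᵥ (x - a))

/-- For `a ≠ 0` the shift moves every basis vector, so the diagonal is zero; for `a = 0` the
diagonal sums a nontrivial character. -/
theorem trace_errorOp (c : ZMod p) {a b : ι → K} (h : (a, b) ≠ 0) :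
    LinearMap.trace ℂ (StateSpace K ι) (errorOp p c a b : StateSpace K ι →ₗ[ℂ] StateSpace K ι) =
      0 := by
  classical
  rw [LinearMap.trace_eq_matrix_trace ℂ (Pi.basisFun ℂ (ι → K)), Matrix.trace]
  have hdiag (x : ι → K) : Matrix.diag (LinearMap.toMatrix (Pi.basisFun ℂ (ι → K))
      (Pi.basisFun ℂ (ι → K)) (errorOp p c a b : StateSpace K ι →ₗ[ℂ] StateSpace K ι)) x =
      ZMod.stdAddChar c * traceChar p K (b ⬝ᵥ (x - a)) *
        (Pi.single x 1 : StateSpace K ι) (x - a) := by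
    rw [Matrix.diag_apply, LinearMap.toMatrix_apply, Pi.basisFun_repr, Pi.basisFun_apply]
    rfl
  simp_rw [hdiag]
  by_cases ha : a = 0
  · subst ha
    obtain ⟨i, hi⟩ : ∃ i, b i ≠ 0 := by
      by_contra! hb
      exact h (Prod.ext rfl (funext hb))
    simp only [sub_zero, Pi.single_eq_same, mul_one, ← Finset.mul_sum]
    refine mul_eq_zero_of_right _ ?_
    let χ : AddChar (ι → K) ℂ := (traceChar p K).compAddMonoidHom
      { toFun x := b ⬝ᵥ x, map_zero' := dotProduct_zero b, map_add' := dotProduct_add b }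
    refine AddChar.sum_eq_zero_of_ne_one (ψ := χ) fun hχ => hi ?_
    refine eq_zero_of_forall_traceChar_mul_eq_one (p := p) fun l => ?_
    have := DFunLike.congr_fun hχ (Pi.single i l)
    rwa [AddChar.one_apply, AddChar.compAddMonoidHom_apply, AddMonoidHom.coe_mk, ZeroHom.coe_mk,
      dotProduct_single, mul_comm] at this
  · refine Finset.sum_eq_zero fun x _ => ?_
    rw [Pi.single_eq_of_ne (fun hx => ha (sub_eq_self.mp hx)), mul_zero]

theorem eq_zero_of_errorOp_eq_one {c : ZMod p} {a b : ι → K} (h : errorOp p c a b = 1) :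
    (a, b) = 0 := by
  by_contra hab
  have h1 := trace_errorOp c hab
  rw [h] at h1
  change LinearMap.trace ℂ (StateSpace K ι) (1 : Module.End ℂ (StateSpace K ι)) = 0 at h1
  rw [LinearMap.trace_one, Module.finrank_fintype_fun_eq_card, Nat.cast_eq_zero] at h1
  exact Fintype.card_ne_zero h1

end ErrorOperators

section IsotropicSpace

variable {p : ℕ} [Fact p.Prime] {K ι : Type*} [Field K] [Algebra (ZMod p) K] [Fintype ι]
  (W : Submodule K ((ι → K) × (ι → K))) (hW : ∀ w ∈ W, ∀ w' ∈ W, w.2 ⬝ᵥ w'.1 = 0)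

/-- The errors `X(a) Z(b)`, `(a, b) ∈ W`, as a homomorphism into the error group. -/
noncomputable def errorHom : Multiplicative W →* (StateSpace K ι ≃ₗ[ℂ] StateSpace K ι) where
  toFun w := errorOp p 0 w.toAdd.1.1 w.toAdd.1.2
  map_one' := errorOp_zero
  -- The phase `tr(b ⬝ᵥ a')` of a product vanishes by `hW`, which asks for more than symplectic
  -- isotropy.
  map_mul' w w' := by
    rw [errorOp_mul, hW _ w.toAdd.2 _ w'.toAdd.2, map_zero, add_zero, add_zero]
    rfl

/-- The representation of `W` on the state space by the errors `X(a) Z(b)`. -/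
noncomputable def errorRep : Representation ℂ (Multiplicative W) (StateSpace K ι) :=
  LinearEquiv.automorphismGroup.toLinearMapMonoidHom.comp (errorHom (p := p) W hW)

variable {W}

theorem mem_invariants_errorRep {φ : StateSpace K ι} :
    φ ∈ (errorRep (p := p) W hW).invariants ↔ ∀ w ∈ W, errorOp p 0 w.1 w.2 φ = φ :=
  ⟨fun h w hw => h (Multiplicative.ofAdd ⟨w, hw⟩), fun h w => h _ w.toAdd.2⟩

theorem isStabilizerCode_invariants (hne : (errorRep (p := p) W hW).invariants ≠ ⊥) :
    IsStabilizerCode p (errorHom (p := p) W hW).range (fun _ => 1)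
      (errorRep (p := p) W hW).invariants where
  le_errorGroup := by
    rintro _ ⟨w, rfl⟩
    exact ⟨0, _, _, rfl⟩
  abelian := by
    rintro _ ⟨w, rfl⟩ _ ⟨w', rfl⟩
    rw [← map_mul, ← map_mul, mul_comm]
  mem_iff φ := by
    rw [mem_invariants_errorRep]
    constructor
    · rintro h _ ⟨w, rfl⟩
      rw [one_smul]
      exact h _ w.toAdd.2
    · intro h w hw
      exact (h (errorHom (p := p) W hW (Multiplicative.ofAdd ⟨w, hw⟩)) ⟨_, rfl⟩).trans (one_smul ℂ φ)
  ne_bot := hne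

variable [Fintype K] [DecidableEq ι]

theorem labels_range_errorHom : labels p (errorHom (p := p) W hW).range = W := by
  ext ⟨a, b⟩
  constructor
  · rintro ⟨c, w, hw⟩
    have h : errorHom (p := p) W hW w * errorHom (p := p) W hW w⁻¹ = 1 := by
      rw [← map_mul, mul_inv_cancel, map_one]
    rw [hw] at h
    change errorOp p c a b * errorOp p 0 (-w.toAdd.1.1) (-w.toAdd.1.2) = 1 at h
    rw [errorOp_mul] at h
    have h0 := eq_zero_of_errorOp_eq_one h
    rw [Prod.mk_eq_zero, ← sub_eq_add_neg, ← sub_eq_add_neg, sub_eq_zero, sub_eq_zero] at h0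
    rw [h0.1, h0.2]
    exact w.toAdd.2
  · intro h
    exact ⟨0, Multiplicative.ofAdd ⟨_, h⟩, rfl⟩

/-- The dimension of the invariants is the average of the character, and only the identity has
nonzero trace. -/
theorem finrank_invariants_errorRep {k : ℕ} (hk : k + Module.finrank K W = Fintype.card ι) :
    Module.finrank ℂ (errorRep (p := p) W hW).invariants = Fintype.card K ^ k := by
  classical
  have hcard : Nat.card (Multiplicative W) = Fintype.card K ^ Module.finrank K W := by
    rw [Nat.card_eq_fintype_card, Fintype.card_multiplicative, Module.card_eq_pow_finrank (K := K)]
  have hq : (Fintype.card K : ℂ) ≠ 0 := Nat.cast_ne_zero.mpr Fintype.card_ne_zero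
  have hne : (Nat.card (Multiplicative W) : ℂ) ≠ 0 := by
    rw [hcard, Nat.cast_pow]
    exact pow_ne_zero _ hq
  have := invertibleOfNonzero hne
  have h := Representation.card_inv_mul_sum_char_eq_finrank (errorRep (p := p) W hW)
  rw [Finset.sum_eq_single 1] at h
  · rw [Representation.character, map_one, LinearMap.trace_one,
      Module.finrank_fintype_fun_eq_card, Fintype.card_fun, ← hk, hcard, pow_add, Nat.cast_mul,
      Nat.cast_pow, Nat.cast_pow, mul_comm, mul_assoc, mul_inv_cancel₀ (pow_ne_zero _ hq),
      mul_one] at h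
    exact_mod_cast h.symm
  · intro w _ hw
    refine trace_errorOp 0 fun h0 => hw ?_
    exact congrArg Multiplicative.ofAdd (Subtype.ext h0 : w.toAdd = 0)
  · intro h1
    exact absurd (Finset.mem_univ _) h1

/-- Some multiple `l • w` labels a unitary that fixes the code but acts on the image of the code
under the error by a scalar other than `1`. That image is therefore orthogonal to the code, and `κ =
0` works. -/
theorem detects_of_exists_ne_zero (c : ZMod p) {a b : ι → K}
    (h : ∃ w ∈ W, w.2 ⬝ᵥ a - b ⬝ᵥ w.1 ≠ 0) :
    Detects (errorRep (p := p) W hW).invariants (errorOp p c a b) := by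
  obtain ⟨w, hw, hne⟩ := h
  obtain ⟨l, hl⟩ : ∃ l : K, traceChar p K (l * (w.2 ⬝ᵥ a - b ⬝ᵥ w.1)) ≠ 1 := by
    by_contra! hall
    exact hne (eq_zero_of_forall_traceChar_mul_eq_one hall)
  refine ⟨0, fun φ hφ ψ hψ => ?_⟩
  rw [mem_invariants_errorRep] at hφ hψ
  have hw' : l • w ∈ W := W.smul_mem l hw
  have hcomm : errorOp p 0 (l • w).1 (l • w).2 (errorOp p c a b ψ) =
      traceChar p K (l * (w.2 ⬝ᵥ a - b ⬝ᵥ w.1)) • errorOp p c a b ψ := by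
    conv_rhs => rw [← hψ _ hw']
    rw [← LinearEquiv.mul_apply, ← LinearEquiv.mul_apply, errorOp_mul, errorOp_mul,
      ← stdAddChar_trace, ← errorOp_add_phase, add_comm a, add_comm b]
    congr 2
    rw [Prod.smul_fst, Prod.smul_snd, smul_dotProduct, dotProduct_smul, smul_eq_mul, smul_eq_mul,
      mul_sub, map_sub]
    ring
  have h := errorOp_unitary (p := p) (l • w).1 (l • w).2 φ (errorOp p c a b ψ)
  rw [hφ _ hw', hcomm, dotProduct_smul, smul_eq_mul] at h
  rw [zero_mul]
  by_contra h0
  exact hl (mul_right_cancel₀ h0 (by rw [h, one_mul]))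

/-- The stabilizer code whose labels are the symplectic dual of `L`. -/
theorem exists_stabilizerCode {L : Submodule K ((ι → K) × (ι → K))}
    (hL : ∀ w ∈ (symplecticForm K ι).orthogonal L, ∀ w' ∈ (symplecticForm K ι).orthogonal L,
      w.2 ⬝ᵥ w'.1 = 0) {k d : ℕ}
    (hk : k + Module.finrank K ((symplecticForm K ι).orthogonal L) = Fintype.card ι)
    (hd : ∀ w ∈ L, w ≠ 0 → d ≤ errorWeight w.1 w.2) :
    ∃ S χ C, IsStabilizerCode p S χ C ∧ labels p S = symplecticDual L ∧
      HasParameters p C (Fintype.card ι) k d := by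
  have hdim := finrank_invariants_errorRep (p := p) hL hk
  refine ⟨_, _, _, isStabilizerCode_invariants (p := p) hL fun h => ?_, labels_range_errorHom hL,
    rfl, hdim, fun c a b hab => ?_⟩
  · rw [h, finrank_bot] at hdim
    exact pow_ne_zero k Fintype.card_ne_zero hdim.symm
  -- A label in `L` of weight below `d` is zero, so the error is a scalar. A label outside `L` fails
  -- to be orthogonal to some stabilizer label, by double duality.
  · by_cases hmem : (a, b) ∈ L
    · have h0 : (a, b) = 0 := by
        by_contra hne
        exact (hd _ hmem hne).not_gt hab
      obtain ⟨rfl, rfl⟩ := Prod.mk_eq_zero.mp h0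
      refine ⟨ZMod.stdAddChar c, fun φ _ ψ _ => ?_⟩
      rw [errorOp_zero_zero_apply, dotProduct_smul, smul_eq_mul]
    · refine detects_of_exists_ne_zero hL c ?_
      by_contra! hall
      refine hmem ?_
      rw [← symplecticForm_orthogonal_orthogonal L]
      intro w hw
      have := hall w hw
      rw [symplecticForm_apply, ← neg_eq_zero, neg_sub, dotProduct_comm a]
      exact this

end IsotropicSpace

/-! ### Hamada's enlargement -/

/-- Identify `M` with the field extension of degree `dim M`: multiplication by an element outside
`K` has no eigenvalue in `K`. -/
theorem exists_linearMap_without_eigenvalues {K M : Type*} [Field K] [Finite K] [AddCommGroup M]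
    [Module K M] [FiniteDimensional K M] (hM : 2 ≤ Module.finrank K M) :
    ∃ f : M →ₗ[K] M, ∀ (κ : K) (u : M), f u = κ • u → u = 0 := by
  obtain ⟨p, _⟩ := CharP.exists K
  have : Fact p.Prime := ⟨CharP.char_is_prime K p⟩
  have : NeZero (Module.finrank K M) := ⟨by omega⟩
  let E := FiniteField.Extension K p (Module.finrank K M)
  have hE : Module.finrank K E = Module.finrank K M := FiniteField.finrank_extension K p _
  obtain ⟨θ, hθ⟩ : ∃ θ : E, θ ∉ (⊥ : Subalgebra K E) := by
    by_contra! h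
    have := Subalgebra.bot_eq_top_iff_finrank_eq_one.mp
      (eq_top_iff.mpr fun x _ => h x : (⊥ : Subalgebra K E) = ⊤)
    omega
  let ε : M ≃ₗ[K] E := LinearEquiv.ofFinrankEq M E hE.symm
  refine ⟨ε.symm.toLinearMap ∘ₗ LinearMap.mulLeft K θ ∘ₗ ε.toLinearMap, fun κ u h => ?_⟩
  have h1 : θ * ε u = algebraMap K E κ * ε u := by
    have := congrArg ε h
    simpa [Algebra.smul_def] using this
  by_contra hu
  refine hθ (Algebra.mem_bot.mpr ⟨κ, ?_⟩)
  exact (mul_right_cancel₀ (by simpa using hu) h1).symm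

section Weight

variable {K ι : Type*} [Field K] [Fintype ι]

theorem ncard_support_eq_sum [DecidableEq K] (c : ι → K) :
    {i | c i ≠ 0}.ncard = ∑ i, if c i = 0 then 0 else 1 := by
  rw [Set.ncard_eq_toFinset_card', Set.toFinset_ofPred, Finset.card_filter]
  exact Finset.sum_congr rfl fun i _ => by simp

theorem ncard_support_fst_le_errorWeight (a b : ι → K) :
    {i | a i ≠ 0}.ncard ≤ errorWeight a b :=
  Set.ncard_le_ncard fun i hi h => hi (Prod.mk.inj h).1

theorem ncard_support_snd_le_errorWeight (a b : ι → K) :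
    {i | b i ≠ 0}.ncard ≤ errorWeight a b :=
  Set.ncard_le_ncard fun i hi h => hi (Prod.mk.inj h).2

/-- The total weight of the words `a + κ b`, `κ ∈ K`, and `b`. -/
theorem sum_ncard_support [Fintype K] (a b : ι → K) :
    ∑ κ : K, {i | (a + κ • b) i ≠ 0}.ncard + {i | b i ≠ 0}.ncard =
      Fintype.card K * errorWeight a b := by
  classical
  have hw : errorWeight a b = ∑ i, if a i = 0 ∧ b i = 0 then 0 else 1 := by
    rw [errorWeight, Set.ncard_eq_toFinset_card', Set.toFinset_ofPred, Finset.card_filter]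
    exact Finset.sum_congr rfl fun i _ => by
      by_cases ha : a i = 0 <;> by_cases hb : b i = 0 <;> simp [ha, hb]
  simp_rw [ncard_support_eq_sum, hw]
  rw [Finset.sum_comm, ← Finset.sum_add_distrib, Finset.mul_sum]
  refine Finset.sum_congr rfl fun i _ => ?_
  simp only [Pi.add_apply, Pi.smul_apply, smul_eq_mul]
  -- Each position outside the joint support counts `0`, each one inside counts `q`: if `b i ≠ 0`,
  -- exactly one `κ` kills `a i + κ * b i`, and `b` itself makes up for it.
  by_cases hb : b i = 0
  · by_cases ha : a i = 0 <;> simp [ha, hb]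
  · have hκ (κ : K) : a i + κ * b i = 0 ↔ κ = -a i / b i := by
      rw [eq_div_iff hb, eq_neg_iff_add_eq_zero, add_comm]
    have h1 : ∑ κ : K, (if κ = -a i / b i then 0 else 1) + 1 = Fintype.card K := by
      have h2 : ∑ κ : K, ((if κ = -a i / b i then 0 else 1) + if κ = -a i / b i then 1 else 0) =
          Fintype.card K := by
        rw [← Finset.card_univ, Finset.card_eq_sum_ones]
        exact Finset.sum_congr rfl fun κ _ => by split_ifs <;> rfl
      rwa [Finset.sum_add_distrib, Finset.sum_ite_eq' Finset.univ, if_pos (Finset.mem_univ _)] at h2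
    simp only [hκ, hb, and_false, if_false, mul_one, h1]

end Weight

theorem finrank_submodule_prod {K V : Type*} [Field K] [AddCommGroup V] [Module K V]
    [FiniteDimensional K V] (C : Submodule K V) :
    Module.finrank K (C.prod C) = 2 * Module.finrank K C := by
  let ε : C.prod C ≃ₗ[K] C × C :=
    { toFun z := (⟨z.1.1, z.2.1⟩, ⟨z.1.2, z.2.2⟩)
      invFun z := ⟨(z.1, z.2), z.1.2, z.2.2⟩
      map_add' _ _ := rfl
      map_smul' _ _ := rfl
      left_inv _ := rfl
      right_inv _ := rfl }
  rw [ε.finrank_eq, Module.finrank_prod, two_mul]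

section Hamada

variable {K ι : Type*} [Field K] [Fintype ι] {C M : Submodule K (ι → K)}

/-- The graph of `f` projects injectively to `M`, hence meets `C × C` only in zero. -/
theorem finrank_hamadaEnlargement (hCM : Disjoint C M) (f : M →ₗ[K] M) :
    Module.finrank K
        (C.prod C ⊔ LinearMap.range (M.subtype.prod (M.subtype ∘ₗ f)) :
          Submodule K ((ι → K) × (ι → K))) =
      Module.finrank K C + Module.finrank K (C ⊔ M : Submodule K (ι → K)) := by
  have hdisj : C.prod C ⊓ LinearMap.range (M.subtype.prod (M.subtype ∘ₗ f)) = ⊥ := by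
    rw [eq_bot_iff]
    rintro _ ⟨⟨h1, -⟩, u, rfl⟩
    have hu : u = 0 := Subtype.ext (Submodule.disjoint_def.mp hCM _ h1 u.2)
    rw [hu, map_zero]
    exact zero_mem _
  have hrange : Module.finrank K (LinearMap.range (M.subtype.prod (M.subtype ∘ₗ f))) =
      Module.finrank K M :=
    LinearMap.finrank_range_of_inj fun u v h => Subtype.ext (congrArg Prod.fst h)
  have h1 := Submodule.finrank_sup_add_finrank_inf_eq (C.prod C)
    (LinearMap.range (M.subtype.prod (M.subtype ∘ₗ f)))
  have h2 := Submodule.finrank_sup_add_finrank_inf_eq C M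
  rw [hdisj, finrank_bot, hrange, finrank_submodule_prod] at h1
  rw [hCM.eq_bot, finrank_bot] at h2
  omega

/-- Nonzero words of an enlargement of `C × C` have weight at least the minimum of `d` and
`(1 + 1 / q) d'`, where `d` and `d'` bound the weights in `C` and `C ⊕ M`. -/
theorem le_errorWeight_of_mem_hamadaEnlargement [Fintype K] (hCM : Disjoint C M) {f : M →ₗ[K] M}
    (hf : ∀ (κ : K) (u : M), f u = κ • u → u = 0) {d d' : ℕ}
    (hC : ∀ c ∈ C, c ≠ 0 → d ≤ {i | c i ≠ 0}.ncard)
    (hCM' : ∀ c ∈ C ⊔ M, c ≠ 0 → d' ≤ {i | c i ≠ 0}.ncard)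
    (hd : ∀ w : ℕ, (Fintype.card K + 1) * d' ≤ Fintype.card K * w → d ≤ w)
    {w : (ι → K) × (ι → K)}
    (hw : w ∈ C.prod C ⊔ LinearMap.range (M.subtype.prod (M.subtype ∘ₗ f))) (hw0 : w ≠ 0) :
    d ≤ errorWeight w.1 w.2 := by
  obtain ⟨⟨c, c'⟩, ⟨hc, hc'⟩, _, ⟨u, rfl⟩, rfl⟩ := Submodule.mem_sup.mp hw
  change c ∈ C at hc
  change c' ∈ C at hc'
  have hsum {x : ι → K} (hx : x ∈ C) {v : M} (hv : v ≠ 0) :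
      d' ≤ {i | (x + (v : ι → K)) i ≠ 0}.ncard := by
    refine hCM' _ (Submodule.add_mem_sup hx v.2) fun h0 => hv (Subtype.ext ?_)
    refine Submodule.disjoint_def.mp hCM _ ?_ v.2
    rw [eq_neg_of_add_eq_zero_right h0]
    exact C.neg_mem hx
  by_cases hu : u = 0
  · subst hu
    rw [map_zero, add_zero] at hw0 ⊢
    by_cases h0 : c = 0
    · refine (hC c' hc' fun h0' => hw0 (Prod.ext h0 h0')).trans ?_
      exact ncard_support_snd_le_errorWeight _ _
    · exact (hC c hc h0).trans (ncard_support_fst_le_errorWeight _ _)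
  -- For `u ≠ 0` the `q + 1` words `a + κ b` and `b` lie in `C ⊔ M`. Their `M`-components `u + κ • f
  -- u` and `f u` are nonzero because `f` has no eigenvalue, so `(q + 1) d'` is at most their total
  -- weight, `q` times the error weight.
  · refine hd _ ?_
    change _ ≤ Fintype.card K * errorWeight (c + (u : ι → K)) (c' + (f u : ι → K))
    have hfu : f u ≠ 0 := fun h => hu (hf 0 u (by rw [h, zero_smul]))
    rw [← sum_ncard_support, add_mul, one_mul]
    refine add_le_add ?_ (hsum hc' hfu)
    rw [← Finset.card_univ, ← smul_eq_mul, ← Finset.sum_const]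
    refine Finset.sum_le_sum fun κ _ => ?_
    have hne : u + κ • f u ≠ 0 := by
      intro h0
      by_cases hκ : κ = 0
      · exact hu (by simpa [hκ] using h0)
      · have h1 : κ⁻¹ • (u + κ • f u) = 0 := by rw [h0, smul_zero]
        rw [smul_add, inv_smul_smul₀ hκ] at h1
        exact hu (hf (-κ⁻¹) u ((eq_neg_of_add_eq_zero_right h1).trans (neg_smul _ _).symm))
    have heq : c + (u : ι → K) + κ • (c' + (f u : ι → K)) =
        c + κ • c' + ((u + κ • f u : M) : ι → K) := by
      rw [Submodule.coe_add, Submodule.coe_smul, smul_add, add_add_add_comm]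
    rw [heq]
    exact hsum (C.add_mem hc (C.smul_mem κ hc')) hne

end Hamada

/-! ### Stabilizer codes from self-orthogonal codes -/

section Codes

theorem isotropic_of_le {K ι : Type*} [Field K] [Fintype ι]
    {E : Submodule K (ι → K)} (hE : E ≤ euclideanDual E)
    {W : Submodule K ((ι → K) × (ι → K))} (hW : W ≤ E.prod E) :
    ∀ w ∈ W, ∀ w' ∈ W, w.2 ⬝ᵥ w'.1 = 0 :=
  fun _ hw _ hw' => hE (hW hw).2 _ (hW hw').1

variable {p : ℕ} [Fact p.Prime] {K ι : Type*} [Field K] [Fintype K] [Algebra (ZMod p) K]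
  [Fintype ι] [DecidableEq ι] {E E' : Submodule K (ι → K)}

/-- The stabilizer code of a Euclidean self-orthogonal code. -/
theorem exists_stabilizerCode_prod (hE : E ≤ euclideanDual E) {k d : ℕ}
    (hk : k + 2 * Module.finrank K E = Fintype.card ι)
    (hd : ∀ c ∈ euclideanDual E, c ≠ 0 → d ≤ {i | c i ≠ 0}.ncard) :
    ∃ S χ C, IsStabilizerCode p S χ C ∧ labels p S = (E : Set (ι → K)) ×ˢ E ∧
      HasParameters p C (Fintype.card ι) k d := by
  have horth := symplecticForm_orthogonal_prod_euclideanDual E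
  obtain ⟨S, χ, C, h1, h2, h3⟩ := exists_stabilizerCode (p := p) (k := k) (d := d)
    (L := (euclideanDual E).prod (euclideanDual E))
    (by rw [horth]; exact isotropic_of_le hE le_rfl)
    (by rw [horth, finrank_submodule_prod, hk])
    (by
      rintro ⟨a, b⟩ ⟨ha, hb⟩ hne
      by_cases h0 : a = 0
      · refine (hd b hb fun h0' => hne (Prod.ext h0 h0')).trans ?_
        exact ncard_support_snd_le_errorWeight _ _
      · exact (hd a ha h0).trans (ncard_support_fst_le_errorWeight _ _))
  refine ⟨S, χ, C, h1, ?_, h3⟩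
  rw [h2, symplecticDual_eq_orthogonal, horth, Submodule.prod_coe]

/-- The stabilizer code obtained by Hamada's enlargement. -/
theorem exists_stabilizerCode_hamada (hE : E ≤ euclideanDual E) (hE' : E' ≤ E)
    (hdim : Module.finrank K E' + 2 ≤ Module.finrank K E) {k d d' : ℕ}
    (hk : k + (Module.finrank K E + Module.finrank K E') = Fintype.card ι)
    (hdE : ∀ c ∈ euclideanDual E, c ≠ 0 → d ≤ {i | c i ≠ 0}.ncard)
    (hdE' : ∀ c ∈ euclideanDual E', c ≠ 0 → d' ≤ {i | c i ≠ 0}.ncard)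
    (hd : ∀ w : ℕ, (Fintype.card K + 1) * d' ≤ Fintype.card K * w → d ≤ w) :
    ∃ S χ C L, IsStabilizerCode p S χ C ∧
      IsHamadaEnlargement (euclideanDual E) (euclideanDual E') L ∧
      labels p S = symplecticDual L ∧ HasParameters p C (Fintype.card ι) k d := by
  obtain ⟨M', hM'⟩ := Submodule.exists_isCompl (euclideanDual E)
  have hle := euclideanDual_anti hE'
  -- Cutting a complement in the whole space down to the larger dual gives a relative complement, by
  -- the modular law.
  let M := M' ⊓ euclideanDual E'
  have hdisj : Disjoint (euclideanDual E) M := hM'.disjoint.mono_right inf_le_left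
  have hsup : euclideanDual E ⊔ M = euclideanDual E' := by
    rw [← sup_inf_assoc_of_le _ hle, hM'.sup_eq_top, top_inf_eq]
  have h1 := finrank_euclideanDual_add E
  have h2 := finrank_euclideanDual_add E'
  have h3 := Submodule.finrank_sup_add_finrank_inf_eq (euclideanDual E) M
  rw [hdisj.eq_bot, finrank_bot, hsup] at h3
  obtain ⟨f, hf⟩ := exists_linearMap_without_eigenvalues (K := K) (M := M) (by omega)
  let L := (euclideanDual E).prod (euclideanDual E) ⊔
    LinearMap.range (M.subtype.prod (M.subtype ∘ₗ f))
  have hL : Module.finrank K L =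
      Module.finrank K (euclideanDual E) + Module.finrank K (euclideanDual E') :=
    (finrank_hamadaEnlargement hdisj f).trans (by rw [hsup])
  -- `L` contains `C × C`, so its dual inherits isotropy from `E × E`.
  have hLE : (symplecticForm K ι).orthogonal L ≤ E.prod E := by
    rw [← symplecticForm_orthogonal_prod_euclideanDual E]
    exact LinearMap.BilinForm.orthogonal_le le_sup_left
  have h4 := finrank_symplecticForm_orthogonal_add L
  obtain ⟨S, χ, C, hS, hl, hp⟩ := exists_stabilizerCode (p := p) (k := k) (d := d) (L := L)
    (isotropic_of_le hE hLE) (by omega) fun w hw hw0 =>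
      le_errorWeight_of_mem_hamadaEnlargement hdisj hf hdE (by rwa [hsup]) hd hw hw0
  exact ⟨S, χ, C, L, hS, ⟨M, hdisj, hsup, f, hf, rfl⟩, hl, hp⟩

end Codes

theorem exists_isPrimitiveRoot_of_dvd_card_sub_one {F : Type*} [Field F] [Fintype F] {n : ℕ}
    (h : n ∣ Fintype.card F - 1) : ∃ ζ : F, IsPrimitiveRoot ζ n := by
  classical
  obtain ⟨g, hg⟩ := IsCyclic.exists_generator (α := Fˣ)
  have hcard := orderOf_eq_card_of_forall_mem_zpowers hg
  rw [Nat.card_eq_fintype_card, Fintype.card_units] at hcard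
  obtain ⟨m, hm⟩ := h
  have hpos : 0 < Fintype.card F - 1 := Nat.sub_pos_of_lt Fintype.one_lt_card
  have hg' : IsPrimitiveRoot (g : F) (Fintype.card F - 1) := by
    rw [IsPrimitiveRoot.coe_units_iff, ← hcard]
    exact IsPrimitiveRoot.orderOf g
  exact ⟨_, hg'.pow hpos (by rw [hm, mul_comm])⟩

end QuantumCodes

theorem theorem2p6 (p r s N : ℕ) [Fact p.Prime] (hr : 0 < r) (hs : 0 < s) (hsr : s ∣ r)
    (hN : 0 < N) (hNr : N - 1 ∣ p ^ r - 1)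
    (F : Type*) [Field F] [Fintype F] [DecidableEq F] (hF : Fintype.card F = p ^ r)
    (K : Type*) [Field K] [Fintype K] [Algebra (ZMod p) K] [Algebra K F]
    (hK : Fintype.card K = p ^ s)
    (z : ℕ) (a : ℕ → ℕ) (ha : StrictMonoOn a (Set.Iic z))
    (haA : a '' Set.Iic z = QuantumCodes.cyclotomicReps (N - 1) (p ^ s))
    (t₁ t₂ : ℕ) (ht₁ : t₁ + 1 ≤ z) (ht : t₂ < t₁)
    (hi : ∀ i ∈ Set.Icc 1 t₁,
      a t₁ < QuantumCodes.cyclotomicRep (N - 1) (p ^ s) ((N - 1 - a i : ℕ) : ZMod (N - 1)))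
    (hii : a (t₁ + 1) ≤ ⌈(((p : ℚ) ^ s + 1) * a (t₂ + 1)) / (p : ℚ) ^ s⌉₊)
    (Δ₁ Δ₂ : Set (ZMod (N - 1)))
    (hΔ₁ : Δ₁ = QuantumCodes.cyclotomicUnion (N - 1) (p ^ s) a t₁)
    (hΔ₂ : Δ₂ = QuantumCodes.cyclotomicUnion (N - 1) (p ^ s) a t₂)
    (E₁ E₂ : Submodule K (QuantumCodes.ZeroSet F (N - 1) → K))
    (hE₁ : E₁ = QuantumCodes.subfieldSubcode K (QuantumCodes.affineVarietyCode F (N - 1) Δ₁))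
    (hE₂ : E₂ = QuantumCodes.subfieldSubcode K (QuantumCodes.affineVarietyCode F (N - 1) Δ₂)) :
    (∃ k : ℕ, k + 2 * Δ₁.ncard = N - 1 ∧
      ∃ S χ C, QuantumCodes.IsStabilizerCode p S χ C ∧
        QuantumCodes.labels p S = (E₁ : Set (QuantumCodes.ZeroSet F (N - 1) → K)) ×ˢ E₁ ∧
        QuantumCodes.HasParameters p C (N - 1) k (a (t₁ + 1))) ∧
    (Δ₂.ncard + 2 ≤ Δ₁.ncard →
      ∃ k : ℕ, k + (Δ₁.ncard + Δ₂.ncard) = N - 1 ∧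
        ∃ S χ C L, QuantumCodes.IsStabilizerCode p S χ C ∧
          QuantumCodes.IsHamadaEnlargement (QuantumCodes.euclideanDual E₁)
            (QuantumCodes.euclideanDual E₂) L ∧
          QuantumCodes.labels p S = QuantumCodes.symplecticDual L ∧
          QuantumCodes.HasParameters p C (N - 1) k (a (t₁ + 1))) := by
  have hK1 : 1 < Fintype.card K := Fintype.one_lt_card
  have hr1 : 1 < Fintype.card F := Fintype.one_lt_card
  obtain ⟨ζ, hζ⟩ := QuantumCodes.exists_isPrimitiveRoot_of_dvd_card_sub_one
    (F := F) (n := N - 1) (hF ▸ hNr)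
  -- The case `N = 1` would make `p ^ r - 1` zero, although `F` has more than one element.
  have hn : N - 1 ≠ 0 := by
    intro h0
    rw [h0, zero_dvd_iff] at hNr
    omega
  generalize N - 1 = n at *
  have : NeZero n := ⟨hn⟩
  have hQ : (p ^ s).Coprime n := by
    refine Nat.Coprime.pow_left s (Nat.Coprime.coprime_dvd_right hNr ?_)
    rw [(Fact.out : p.Prime).coprime_iff_not_dvd]
    intro hdvd
    have h1 : p ∣ p ^ r - (p ^ r - 1) := Nat.dvd_sub (dvd_pow_self p hr.ne') hdvd
    rw [Nat.sub_sub_self (by omega), Nat.dvd_one] at h1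
    exact (Fact.out : p.Prime).one_lt.ne' h1
  have hcard := QuantumCodes.card_zeroSet hζ
  have hclosed (t : ℕ) : ∀ e ∈ QuantumCodes.cyclotomicUnion n (p ^ s) a t,
      (Nat.card K : ZMod n) * e ∈ QuantumCodes.cyclotomicUnion n (p ^ s) a t := by
    rw [Nat.card_eq_fintype_card, hK]
    exact fun e he => QuantumCodes.mul_mem_cyclotomicUnion he
  have hdim₁ : Module.finrank K E₁ = Δ₁.ncard := by
    rw [hE₁, hΔ₁, QuantumCodes.finrank_subfieldSubcode_affineVarietyCode hζ (hclosed t₁)]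
  have hdim₂ : Module.finrank K E₂ = Δ₂.ncard := by
    rw [hE₂, hΔ₂, QuantumCodes.finrank_subfieldSubcode_affineVarietyCode hζ (hclosed t₂)]
  have hself : E₁ ≤ QuantumCodes.euclideanDual E₁ := by
    rw [hE₁, hΔ₁]
    exact QuantumCodes.subfieldSubcode_le_euclideanDual hζ fun e he =>
      QuantumCodes.neg_notMem_cyclotomicUnion hQ ha haA ht₁ hi he
  have hle : E₂ ≤ E₁ := by
    rw [hE₁, hE₂, hΔ₁, hΔ₂]
    exact QuantumCodes.subfieldSubcode_affineVarietyCode_mono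
      (QuantumCodes.cyclotomicUnion_mono ht.le)
  have hd₁ : ∀ c ∈ QuantumCodes.euclideanDual E₁, c ≠ 0 → a (t₁ + 1) ≤ {i | c i ≠ 0}.ncard := by
    intro c hc hc0
    rw [hE₁, hΔ₁] at hc
    exact QuantumCodes.le_ncard_support_of_mem_euclideanDual (hclosed t₁)
      (fun e h0 he => (QuantumCodes.cast_mem_cyclotomicUnion hQ ha haA ht₁ h0 he).2) hc0 hc
  have hd₂ : ∀ c ∈ QuantumCodes.euclideanDual E₂, c ≠ 0 → a (t₂ + 1) ≤ {i | c i ≠ 0}.ncard := by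
    intro c hc hc0
    rw [hE₂, hΔ₂] at hc
    exact QuantumCodes.le_ncard_support_of_mem_euclideanDual (hclosed t₂)
      (fun e h0 he => (QuantumCodes.cast_mem_cyclotomicUnion hQ ha haA (by omega) h0 he).2) hc0 hc
  -- Self-orthogonality gives `2 * dim E₁ ≤ n`, so the truncated subtractions defining `k` below are
  -- exact.
  have hdual := QuantumCodes.finrank_euclideanDual_add E₁
  have hmono := Submodule.finrank_mono hself
  rw [hcard] at hdual
  refine ⟨⟨n - 2 * Δ₁.ncard, by omega, ?_⟩, fun hΔ => ⟨n - (Δ₁.ncard + Δ₂.ncard), by omega, ?_⟩⟩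
  · obtain ⟨S, χ, C, h1, h2, h3⟩ := QuantumCodes.exists_stabilizerCode_prod (p := p) hself
      (k := n - 2 * Δ₁.ncard) (by omega) hd₁
    exact ⟨S, χ, C, h1, h2, by rwa [hcard] at h3⟩
  · obtain ⟨S, χ, C, L, h1, h2, h3, h4⟩ := QuantumCodes.exists_stabilizerCode_hamada (p := p)
      hself hle (by omega) (k := n - (Δ₁.ncard + Δ₂.ncard)) (by omega) hd₁ hd₂ fun w hw => by
        -- An integer `w` with `(q + 1) d' ≤ q w` is at least the ceiling in hypothesis (ii).
        refine hii.trans (Nat.ceil_le.mpr ?_)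
        rw [hK] at hw
        rw [div_le_iff₀ (pow_pos (Nat.cast_pos.mpr (Fact.out : p.Prime).pos) s), mul_comm (w : ℚ)]
        exact_mod_cast hw
    exact ⟨S, χ, C, L, h1, h2, h3, by rwa [hcard] at h4⟩
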